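/- Let $\Gamma$ be a group and $\mathcal S\subset\Gamma$ a finite symmetric generating set with $e\notin\mathcal S$ and $|\mathcal S|=d\ge 3$, such that the (left) Cayley graph of $\Gamma$ with respect to $\mathcal S$ (with $x\sim y$ iff $yx^{-1}\in\mathcal S$) is a tree, hence the infinite $d$-regular tree $\mathbb T_d$. Let $p\in[0,1)$. The elephant random walk on this graph with memory parameter $p$ is the process $(w_n)_{n\ge 0}$ with $w_0=e$ and $w_n=g_n\cdots g_1$ for $n\ge1$, where the random steps $g_k\in\mathcal S$ are generated as follows: $g_1$ is uniform on $\mathcal S$; for $n\ge1$, given $g_1,\dots,g_n$, a time $D$ is chosen uniformly from $\{1,\dots,n\}$, and then $g_{n+1}=g_D$ with probability $p$, while $g_{n+1}=a$ with probability $\frac{1-p}{d-1}$ for each $a\in\mathcal S\setminus\{g_D\}$. Let $\Delta_n$ be the distance from $w_n$ to $e$ in the Cayley graph (the word length of $w_n$), let $p_d=\frac{d+1}{2d}$, and set \[ r_n=\begin{cases} n^{1/2} & \text{if } p<p_d,\\ \left(\frac{n}{\log n}\right)^{1/2} & \text{if } p=p_d,\\ n^{\frac{d(1-p)}{d-1}}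 & \text{if } p>p_d,\end{cases} \] with the convention $r_1=0$ when $p=p_d$. Then the sequence of real random variables \[ r_n\left(\frac{\Delta_n}{n}-\frac{d-2}{d}\right),\qquad n\ge1, \] is tight: for every $\varepsilon>0$ there is a compact set $K\subset\mathbb R$ such that $\mathbb P\left(r_n\left(\frac{\Delta_n}{n}-\frac{d-2}{d}\right)\notin K\right)\le\varepsilon$ for all $n\ge1$. -/

import Mathlib

open MeasureTheory

noncomputable section

/-- The left Cayley graph of `Γ` with respect to `S`: distinct `x`, `y` are adjacent iff
`y * x⁻¹ ∈ S` or `x * y⁻¹ ∈ S` (the two conditions agree when `S` is symmetric). -/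
def leftCayleyGraph {Γ : Type*} [Group Γ] (S : Finset Γ) : SimpleGraph Γ :=
  SimpleGraph.fromRel fun x y => y * x⁻¹ ∈ S

/-- The event that the steps at times `1, …, n` are `a 1, …, a n`. -/
def historyEvent {Γ Ω : Type*} {S : Finset Γ} (g : ℕ → Ω → S) (n : ℕ) (a : ℕ → S) : Set Ω :=
  {ω | ∀ k ∈ Finset.Icc 1 n, g k ω = a k}

/-- `g 1, g 2, …` are the steps of an elephant random walk with step set `S` and memory parameter
`p`, and `D n` is the time in `{1, …, n}` recalled when the step `g (n + 1)` is taken.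
The variables `g 0` and `D 0` play no role. The conditional laws are written in product form:
* the first step is uniform on `S`;
* given the steps up to time `n`, the time `D n` is uniform on `{1, …, n}`;
* given these steps and `D n = i`, the step `g (n + 1)` repeats `g i` with probability `p`, and
  is any given other element of `S` with probability `(1 - p) / (|S| - 1)`. -/
structure IsElephantWalk {Γ Ω : Type*} [DecidableEq Γ] [MeasurableSpace Ω]
    (S : Finset Γ) (p : ℝ) (μ : Measure Ω) (g : ℕ → Ω → S) (D : ℕ → Ω → ℕ) : Prop where
  measurableSet_step : ∀ n, 1 ≤ n → ∀ b : S, MeasurableSet {ω | g n ω = b}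
  measurableSet_memory : ∀ n, 1 ≤ n → ∀ i : ℕ, MeasurableSet {ω | D n ω = i}
  first_step : ∀ b : S, μ.real {ω | g 1 ω = b} = 1 / (S.card : ℝ)
  memory : ∀ n, 1 ≤ n → ∀ a : ℕ → S, ∀ i ∈ Finset.Icc 1 n,
    μ.real (historyEvent g n a ∩ {ω | D n ω = i}) = 1 / (n : ℝ) * μ.real (historyEvent g n a)
  next_step : ∀ n, 1 ≤ n → ∀ a : ℕ → S, ∀ i ∈ Finset.Icc 1 n, ∀ b : S,
    μ.real (historyEvent g n a ∩ {ω | D n ω = i} ∩ {ω | g (n + 1) ω = b}) =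
      (if b = a i then p else (1 - p) / ((S.card : ℝ) - 1)) *
        μ.real (historyEvent g n a ∩ {ω | D n ω = i})

/-- The position `w n = g n * ⋯ * g 1` of the walk at time `n`, with `w 0 = 1`. -/
def walkPosition {Γ Ω : Type*} [Group Γ] {S : Finset Γ} (g : ℕ → Ω → S) : ℕ → Ω → Γ
  | 0, _ => 1
  | n + 1, ω => (g (n + 1) ω : Γ) * walkPosition g n ω

/-- The distance `Δ n` from the identity at time `n`, in the word metric, i.e. the graph distance
of the Cayley graph. -/
def walkDistance {Γ Ω : Type*} [Group Γ] {S : Finset Γ} (g : ℕ → Ω → S) (n : ℕ) (ω : Ω) : ℕ :=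
  (leftCayleyGraph S).dist (walkPosition g n ω) 1

/-- The critical memory parameter `p_d = (d + 1) / (2 d)`. -/
def criticalMemory (d : ℕ) : ℝ := ((d : ℝ) + 1) / (2 * (d : ℝ))

/-- The normalisation `r_n(p, d)`. In the critical case the formula makes sense for `n ≥ 2` only;
at `n = 1` it takes the value `0` here, by `1 / 0 = 0`. -/
def speedRate (d : ℕ) (p : ℝ) (n : ℕ) : ℝ :=
  if p < criticalMemory d then (n : ℝ) ^ (1 / 2 : ℝ)
  else if p = criticalMemory d then ((n : ℝ) / Real.log n) ^ (1 / 2 : ℝ)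
  else (n : ℝ) ^ ((d : ℝ) * (1 - p) / ((d : ℝ) - 1))

/-- The random variable `r_n (Δ n / n - (d - 2) / d)`. -/
def normalizedSpeed {Γ Ω : Type*} [Group Γ] {S : Finset Γ} (d : ℕ) (p : ℝ) (g : ℕ → Ω → S)
    (n : ℕ) (ω : Ω) : ℝ :=
  speedRate d p n * ((walkDistance g n ω : ℝ) / (n : ℝ) - ((d : ℝ) - 2) / (d : ℝ))

end

/-! Write `d = |S|` and `α = (d p - 1) / (d - 1)`. Averaging over the recalled time, the next step
is `b` with conditional probability `1/d + α X_n(b) / n`, where `X_n(b)` is the excess of the count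
of `b` over `n/d`. Hence `E X_n(b)²` grows at most by the factor `1 + 2α/n` and an additive constant
per step.

In the tree, away from the identity, exactly one generator `c` shortens the word. With `Y_n = Δ_n -
n (d - 2) / d`, the conditional drift of `Y_n` is therefore `-2α X_n(c) / n`; at the identity `Y_n ≤
0`, so reflection only helps. Young's inequality separates `Y` from `X` in the cross term: `E
Y_{n+1}² ≤ (1 + 1/(2n)) E Y_n² + (8α²/n) ∑ E X_n(a)² + 8`.

Both recursions are dominated by multiples of one function `f` (`IsMomentRate`): `n`, `n (1 + log
n)` or `2 n^{2α} - n`, according as `α` is below, at or above `1/2`, that is, `p` against `p_d`.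
Since `r_n² f(n) = O(n²)`, the normalized variables are bounded in `L²`, and Chebyshev's inequality
gives tightness. -/

/-- The steps at times `1, …, n`, as a function to a finite type. -/
def history {Ω ι : Type*} (g : ℕ → Ω → ι) (n : ℕ) (ω : Ω) : Fin n → ι := fun k => g (k + 1) ω

lemma history_eq_iff {Ω ι : Type*} {g : ℕ → Ω → ι} {n : ℕ} {ω ω' : Ω} :
    history g n ω = history g n ω' ↔ ∀ k ∈ Finset.Icc 1 n, g k ω = g k ω' := by
  rw [funext_iff]
  refine ⟨fun h k hk => ?_, fun h k => h _ (Finset.mem_Icc.2 ⟨by omega, k.2⟩)⟩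
  rw [Finset.mem_Icc] at hk
  have := h ⟨k - 1, by omega⟩
  simpa only [history, Nat.sub_add_cancel hk.1] using this

/-- A version of the law of the unconscious statistician for functions of a random element of a
finite type, restricted to an event. -/
lemma setIntegral_comp_fintype {Ω ι : Type*} [MeasurableSpace Ω] [Fintype ι] (μ : Measure Ω)
    [IsFiniteMeasure μ] {h : Ω → ι} (hh : ∀ t, MeasurableSet (h ⁻¹' {t})) (z : ι → ℝ)
    (B : Set Ω) :
    ∫ ω in B, z (h ω) ∂μ = ∑ t, μ.real (h ⁻¹' {t} ∩ B) * z t := by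
  let _ : MeasurableSpace ι := ⊤
  have hm : Measurable h := measurable_to_countable' hh
  have : IsFiniteMeasure ((μ.restrict B).map h) := by infer_instance
  rw [← integral_map (φ := h) (f := z) hm.aemeasurable
    (measurable_of_finite z).aestronglyMeasurable, integral_fintype (.of_finite)]
  refine Finset.sum_congr rfl fun t _ => ?_
  rw [map_measureReal_apply hm (MeasurableSet.singleton t), smul_eq_mul,
    measureReal_restrict_apply (hh t)]

/-! ### Step counts and the conditional law of the next step -/

section Walk

variable {Γ Ω : Type*} {S : Finset Γ}

/-- The number of times in `{1, …, n}` at which the step is `a`. -/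
noncomputable def stepCount [DecidableEq Γ] (g : ℕ → Ω → S) (n : ℕ) (a : S) (ω : Ω) : ℝ :=
  ∑ k ∈ Finset.Icc 1 n, if g k ω = a then 1 else 0

/-- The deviation of `stepCount` from `n / |S|`. -/
noncomputable def stepExcess [DecidableEq Γ] (g : ℕ → Ω → S) (n : ℕ) (a : S) (ω : Ω) : ℝ :=
  stepCount g n a ω - n / (S.card : ℝ)

/-- The reinforcement parameter `(d p - 1) / (d - 1)`. -/
noncomputable def reinforcement (d : ℕ) (p : ℝ) : ℝ := ((d : ℝ) * p - 1) / ((d : ℝ) - 1)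

/-- The conditional probability that the step at time `n + 1` is `b`, given the first `n` steps. -/
noncomputable def stepProb [DecidableEq Γ] (p : ℝ) (g : ℕ → Ω → S) (n : ℕ) (b : S) (ω : Ω) : ℝ :=
  1 / (S.card : ℝ) + reinforcement S.card p * stepExcess g n b ω / n

lemma preimage_history_singleton (g : ℕ → Ω → S) (n : ℕ) (ω : Ω) :
    history g n ⁻¹' {history g n ω} = historyEvent g n fun k => g k ω := by
  ext ω'
  simp only [Set.mem_preimage, Set.mem_singleton_iff, history_eq_iff, historyEvent,
    Set.mem_ofPred_eq]

variable [DecidableEq Γ]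

lemma stepCount_factorsThrough (g : ℕ → Ω → S) (n : ℕ) (a : S) :
    (stepCount g n a).FactorsThrough (history g n) := fun ω ω' h =>
  Finset.sum_congr rfl fun k hk => by rw [history_eq_iff.1 h k hk]

lemma stepExcess_factorsThrough (g : ℕ → Ω → S) (n : ℕ) (a : S) :
    (stepExcess g n a).FactorsThrough (history g n) := fun ω ω' h => by
  rw [stepExcess, stepExcess, stepCount_factorsThrough g n a h]

lemma stepProb_factorsThrough (p : ℝ) (g : ℕ → Ω → S) (n : ℕ) (b : S) :
    (stepProb p g n b).FactorsThrough (history g n) := fun ω ω' h => by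
  rw [stepProb, stepProb, stepExcess_factorsThrough g n b h]

lemma sum_stepCount (g : ℕ → Ω → S) (n : ℕ) (ω : Ω) : ∑ a, stepCount g n a ω = n := by
  simp only [stepCount]
  rw [Finset.sum_comm]
  simp

lemma sum_stepProb (hS : 2 ≤ S.card) (p : ℝ) (g : ℕ → Ω → S) (n : ℕ) (ω : Ω) :
    ∑ b, stepProb p g n b ω = 1 := by
  have hS' : (S.card : ℝ) ≠ 0 := by positivity
  have h0 : ∑ b, stepExcess g n b ω = 0 := by
    simp only [stepExcess, Finset.sum_sub_distrib, sum_stepCount, Finset.sum_const,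
      Finset.card_univ, Fintype.card_coe, nsmul_eq_mul]
    field_simp
    simp
  simp only [stepProb, Finset.sum_add_distrib, ← Finset.sum_div, ← Finset.mul_sum, h0,
    Finset.sum_const, Finset.card_univ, Fintype.card_coe, nsmul_eq_mul]
  field_simp
  simp

/-- Total probability over the recalled time. Recalling `b` rather than another generator raises the
chance of `b` by `p - (1 - p) / (d - 1) = α`, so the average is affine in the count of `b`. -/
lemma sum_memory_law (hS : 2 ≤ S.card) (p : ℝ) (g : ℕ → Ω → S) {n : ℕ} (hn : 1 ≤ n) (b : S)
    (ω : Ω) :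
    ∑ k ∈ Finset.Icc 1 n, (if b = g k ω then p else (1 - p) / ((S.card : ℝ) - 1)) * (1 / (n : ℝ))
      = stepProb p g n b ω := by
  have h2 : (2 : ℝ) ≤ S.card := by exact_mod_cast hS
  have h1 : (S.card : ℝ) - 1 ≠ 0 := by linarith
  have h0 : (S.card : ℝ) ≠ 0 := by linarith
  have hn' : (n : ℝ) ≠ 0 := by positivity
  have : ∀ k, (if b = g k ω then p else (1 - p) / ((S.card : ℝ) - 1)) * (1 / (n : ℝ)) =
      (1 - p) / ((S.card : ℝ) - 1) * (1 / (n : ℝ)) +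
        reinforcement S.card p / n * (if g k ω = b then 1 else 0) := by
    intro k
    rw [reinforcement]
    rcases eq_or_ne b (g k ω) with h | h
    · rw [if_pos h, if_pos h.symm]; field_simp; ring
    · rw [if_neg h, if_neg h.symm]; ring
  simp only [this, Finset.sum_add_distrib, ← Finset.mul_sum]
  rw [← stepCount, stepProb, stepExcess, reinforcement]
  simp only [Finset.sum_const, Nat.card_Icc, Nat.add_sub_cancel, nsmul_eq_mul]
  field_simp
  ring

/-- The sign is invisible in the defining formula, where `α` and the excess may be negative; it
comes from the average over recalled times. -/
lemma stepProb_nonneg (hS : 2 ≤ S.card) {p : ℝ} (hp : p ∈ Set.Icc (0 : ℝ) 1) (g : ℕ → Ω → S)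
    {n : ℕ} (hn : 1 ≤ n) (b : S) (ω : Ω) : 0 ≤ stepProb p g n b ω := by
  have h2 : (2 : ℝ) ≤ S.card := by exact_mod_cast hS
  rw [← sum_memory_law hS p g hn]
  refine Finset.sum_nonneg fun k _ => mul_nonneg ?_ (by positivity)
  split_ifs
  · exact hp.1
  · exact div_nonneg (by linarith [hp.2]) (by linarith)

variable [MeasurableSpace Ω] {μ : Measure Ω} {p : ℝ} {g : ℕ → Ω → S} {D : ℕ → Ω → ℕ}

namespace IsElephantWalk

lemma measurableSet_historyEvent (hg : IsElephantWalk S p μ g D) (n : ℕ) (a : ℕ → S) :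
    MeasurableSet (historyEvent g n a) := by
  have : historyEvent g n a = ⋂ k ∈ Finset.Icc 1 n, {ω | g k ω = a k} := by
    ext; simp [historyEvent]
  rw [this]
  exact Finset.measurableSet_biInter _ fun k hk =>
    hg.measurableSet_step k (Finset.mem_Icc.1 hk).1 _

lemma measurableSet_preimage_history (hg : IsElephantWalk S p μ g D) (n : ℕ) (t : Fin n → S) :
    MeasurableSet (history g n ⁻¹' {t}) := by
  by_cases h : ∃ ω, history g n ω = t
  · obtain ⟨ω, rfl⟩ := h
    rw [preimage_history_singleton]
    exact hg.measurableSet_historyEvent n _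
  · convert MeasurableSet.empty
    ext ω
    simpa using fun h' => h ⟨ω, h'⟩

/-- Factoring through `history g n` serves as measurability with respect to the first `n` steps.
There are finitely many histories, so measurability and boundedness are automatic and conditional
expectations are finite sums. -/
lemma measurable_of_factorsThrough (hg : IsElephantWalk S p μ g D) {n : ℕ} {Z : Ω → ℝ}
    (hZ : Z.FactorsThrough (history g n)) : Measurable Z := by
  let _ : MeasurableSpace (Fin n → S) := ⊤
  have hm : Measurable (history g n) :=
    measurable_to_countable' (hg.measurableSet_preimage_history n)
  obtain ⟨z, rfl⟩ := (Function.factorsThrough_iff Z).1 hZ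
  exact (measurable_of_finite z).comp hm

variable [IsProbabilityMeasure μ]

lemma integrable_of_factorsThrough (hg : IsElephantWalk S p μ g D) {n : ℕ} {Z : Ω → ℝ}
    (hZ : Z.FactorsThrough (history g n)) : Integrable Z μ := by
  have hm := hg.measurable_of_factorsThrough hZ
  obtain ⟨z, rfl⟩ := (Function.factorsThrough_iff Z).1 hZ
  refine Integrable.of_bound hm.aestronglyMeasurable (∑ t, ‖z t‖) (.of_forall fun ω => ?_)
  exact Finset.single_le_sum (f := fun t => ‖z t‖) (fun _ _ => norm_nonneg _) (Finset.mem_univ _)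

/-- Given the first `n` steps, the recalled time lies in `{1, …, n}` almost surely. -/
lemma measureReal_historyEvent_inter (hg : IsElephantWalk S p μ g D) {n : ℕ} (hn : 1 ≤ n)
    (a : ℕ → S) (B : Set Ω) :
    μ.real (historyEvent g n a ∩ B) =
      ∑ i ∈ Finset.Icc 1 n, μ.real (historyEvent g n a ∩ {ω | D n ω = i} ∩ B) := by
  set H := historyEvent g n a
  have hn' : (n : ℝ) ≠ 0 := by positivity
  have hH := hg.measurableSet_historyEvent n a
  have hm : ∀ i, MeasurableSet {ω | D n ω = i} := hg.measurableSet_memory n hn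
  set U : Set Ω := {ω | D n ω ∈ Finset.Icc 1 n} with hU
  have hUU : U = ⋃ i ∈ Finset.Icc 1 n, {ω | D n ω = i} := by ext; simp [hU]
  have hUm : MeasurableSet U := hUU ▸ Finset.measurableSet_biUnion _ fun i _ => hm i
  have key : ∀ A : Set Ω,
      μ.real (A ∩ U) = ∑ i ∈ Finset.Icc 1 n, μ.real (A ∩ {ω | D n ω = i}) := by
    intro A
    have h1 : ∀ E, MeasurableSet E → μ.real (A ∩ E) = (μ.restrict A).real E := fun E hE => by
      rw [measureReal_restrict_apply hE, Set.inter_comm]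
    rw [h1 _ hUm, Finset.sum_congr rfl fun i _ => h1 _ (hm i), hUU,
      measureReal_biUnion_finset _ fun i _ => hm i]
    intro i _ j _ hij
    exact Set.disjoint_left.2 fun ω h h' => hij (h.symm.trans h')
  -- The `n` admissible recalled times each carry mass `μ(H) / n`, which already exhausts `H`.
  have hzero : μ.real (H \ U) = 0 := by
    have h1 := measureReal_inter_add_sdiff (μ := μ) (s := H) hUm
    have h2 : μ.real (H ∩ U) = μ.real H := by
      rw [key, Finset.sum_congr rfl fun i hi => hg.memory n hn a i hi]
      simp only [Finset.sum_const, Nat.card_Icc, Nat.add_sub_cancel, nsmul_eq_mul]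
      field_simp
      rfl
    linarith
  have h3 := measureReal_inter_add_sdiff (μ := μ) (s := H ∩ B) hUm
  have h4 : μ.real ((H ∩ B) \ U) = 0 :=
    le_antisymm ((measureReal_mono (Set.sdiff_subset_sdiff_left Set.inter_subset_left)).trans hzero.le) measureReal_nonneg
  rw [← h3, h4, add_zero, key]
  exact Finset.sum_congr rfl fun i _ => by rw [Set.inter_right_comm]

lemma measureReal_history_inter_step (hg : IsElephantWalk S p μ g D) (hS : 2 ≤ S.card) {n : ℕ}
    (hn : 1 ≤ n) (b : S) (ω : Ω) :
    μ.real (history g n ⁻¹' {history g n ω} ∩ {ω | g (n + 1) ω = b}) =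
      stepProb p g n b ω * μ.real (history g n ⁻¹' {history g n ω}) := by
  rw [preimage_history_singleton, hg.measureReal_historyEvent_inter hn, ← sum_memory_law hS p g hn,
    Finset.sum_mul]
  refine Finset.sum_congr rfl fun i hi => ?_
  rw [hg.next_step n hn _ i hi, hg.memory n hn _ i hi, mul_assoc]

/-- The conditional law of the step at time `n + 1`, in integrated form. -/
lemma integral_step (hg : IsElephantWalk S p μ g D) (hS : 2 ≤ S.card) {n : ℕ} (hn : 1 ≤ n)
    {F : S → Ω → ℝ} (hF : ∀ b, (F b).FactorsThrough (history g n)) :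
    ∫ ω, F (g (n + 1) ω) ω ∂μ = ∫ ω, ∑ b, stepProb p g n b ω * F b ω ∂μ := by
  have hB := hg.measurableSet_step (n + 1) (by omega)
  have hone : ∀ b, ∫ ω in {ω | g (n + 1) ω = b}, F b ω ∂μ = ∫ ω, stepProb p g n b ω * F b ω ∂μ := by
    intro b
    obtain ⟨z, hz⟩ := (Function.factorsThrough_iff _).1 (hF b)
    obtain ⟨q, hq⟩ := (Function.factorsThrough_iff _).1 (stepProb_factorsThrough p g n b)
    have h1 := setIntegral_comp_fintype μ (hg.measurableSet_preimage_history n) z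
      {ω | g (n + 1) ω = b}
    have h2 := setIntegral_comp_fintype μ (hg.measurableSet_preimage_history n)
      (fun t => q t * z t) Set.univ
    rw [setIntegral_univ] at h2
    rw [hq, hz]
    refine h1.trans (Eq.trans ?_ h2.symm)
    refine Finset.sum_congr rfl fun t _ => ?_
    rw [Set.inter_univ]
    by_cases h : ∃ ω, history g n ω = t
    · obtain ⟨ω, rfl⟩ := h
      rw [hg.measureReal_history_inter_step hS hn b ω, hq, Function.comp_apply]
      ring
    · have : history g n ⁻¹' {t} = ∅ := by
        ext ω
        simpa using fun h' => h ⟨ω, h'⟩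
      simp [this]
  rw [integral_finsetSum _ fun b _ => hg.integrable_of_factorsThrough (n := n) fun ω ω' h => by
    rw [stepProb_factorsThrough p g n b h, hF b h], ← Finset.sum_congr rfl fun b _ => hone b]
  have hsum : ∀ ω, F (g (n + 1) ω) ω = ∑ b, {ω | g (n + 1) ω = b}.indicator (F b) ω := by
    intro ω
    simp [Set.indicator_apply]
  simp only [hsum]
  rw [integral_finsetSum _ fun b _ => (hg.integrable_of_factorsThrough (hF b)).indicator (hB b)]
  exact Finset.sum_congr rfl fun b _ => integral_indicator (hB b)

end IsElephantWalk

end Walk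

/-! ### Distances in the tree -/

/-- In a tree, all neighbours of `w` but one are farther from a vertex `v ≠ w` than `w` is. -/
lemma SimpleGraph.IsTree.exists_adj_forall_dist {V : Type*} {G : SimpleGraph V} (hG : G.IsTree)
    {v w : V} (hw : w ≠ v) :
    ∃ u, G.Adj w u ∧ G.dist w v = G.dist u v + 1 ∧
      ∀ u', G.Adj w u' → u' ≠ u → G.dist u' v = G.dist w v + 1 := by
  classical
  obtain ⟨q, hq, hl⟩ := hG.connected.exists_path_of_dist w v
  have hnil : ¬ q.Nil := SimpleGraph.Walk.not_nil_of_ne hw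
  have hfar : ∀ u', G.Adj w u' → u' ≠ q.snd → G.dist u' v = G.dist w v + 1 := by
    intro u' hu' hne
    rcases hG.dist_eq_dist_add_one_of_adj v hu' with h | h
    · obtain ⟨r, hr, hrl⟩ := hG.connected.exists_path_of_dist u' v
      exfalso
      -- A second neighbour `u'` closer to `v` has a geodesic avoiding `w`, which is too far to lie
      -- on it. Prefixing `w` gives another path from `w` to `v`, against uniqueness of paths.
      have hwr : w ∉ r.support := by
        intro hmem
        have h1 := SimpleGraph.dist_le (r.dropUntil w hmem)
        have h2 := r.length_dropUntil_le_length hmem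
        rw [G.dist_comm (u := v), G.dist_comm (u := v)] at h
        omega
      have := hG.isAcyclic.subsingleton_path w v |>.elim ⟨q, hq⟩ ⟨_, hr.cons (h := hu') hwr⟩
      rw [Subtype.mk.injEq] at this
      exact hne (by rw [this, SimpleGraph.Walk.snd_cons])
    · rwa [G.dist_comm (u := v), G.dist_comm (u := v)] at h
  refine ⟨q.snd, q.adj_snd hnil, ?_, hfar⟩
  rcases hG.dist_eq_dist_add_one_of_adj v (q.adj_snd hnil) with h | h
  · rwa [G.dist_comm (u := v), G.dist_comm (u := v)] at h
  · have h1 := SimpleGraph.dist_le q.tail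
    have h2 := q.length_tail_add_one hnil
    rw [G.dist_comm (u := v), G.dist_comm (u := v)] at h
    omega

section Walk

variable {Γ Ω : Type*} [Group Γ] {S : Finset Γ}

lemma leftCayleyGraph_adj_mul_left (hone : (1 : Γ) ∉ S) {s : Γ} (hs : s ∈ S) (w : Γ) :
    (leftCayleyGraph S).Adj w (s * w) := by
  rw [leftCayleyGraph, SimpleGraph.fromRel_adj]
  exact ⟨fun h => hone (mul_eq_right.1 h.symm ▸ hs), Or.inl (by simpa using hs)⟩

lemma exists_mul_left_of_leftCayleyGraph_adj (hsymm : ∀ s ∈ S, s⁻¹ ∈ S) {w u : Γ}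
    (h : (leftCayleyGraph S).Adj w u) : ∃ s ∈ S, u = s * w := by
  rw [leftCayleyGraph, SimpleGraph.fromRel_adj] at h
  refine ⟨u * w⁻¹, ?_, by simp⟩
  rcases h.2 with h | h
  · exact h
  · simpa using hsymm _ h

/-- Away from the identity, exactly one generator decreases the word length. -/
lemma exists_forall_dist_mul_left [DecidableEq Γ] (hsymm : ∀ s ∈ S, s⁻¹ ∈ S) (hone : (1 : Γ) ∉ S)
    (htree : (leftCayleyGraph S).IsTree) {w : Γ} (hw : w ≠ 1) :
    ∃ c : S, ∀ b : S, ((leftCayleyGraph S).dist ((b : Γ) * w) 1 : ℝ) =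
      (leftCayleyGraph S).dist w 1 + if b = c then -1 else 1 := by
  obtain ⟨u, hu, hdist, hfar⟩ := htree.exists_adj_forall_dist hw
  obtain ⟨c, hc, rfl⟩ := exists_mul_left_of_leftCayleyGraph_adj hsymm hu
  refine ⟨⟨c, hc⟩, fun b => ?_⟩
  split_ifs with h
  · rw [h, hdist]
    push_cast
    ring
  · rw [hfar _ (leftCayleyGraph_adj_mul_left hone b.2 w) fun h' => h (Subtype.ext (by simpa using h'))]
    push_cast
    ring

lemma dist_generator_one (hone : (1 : Γ) ∉ S) (b : S) :
    (leftCayleyGraph S).dist (b : Γ) 1 = 1 := by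
  rw [SimpleGraph.dist_eq_one_iff_adj, SimpleGraph.adj_comm]
  simpa using leftCayleyGraph_adj_mul_left hone b.2 1

end Walk

/-! ### Growth rates for the moment recursions -/

/-- `f` dominates the solutions of the recursions satisfied by the second moments of an elephant
random walk with reinforcement parameter `α`. -/
structure IsMomentRate (α : ℝ) (f : ℕ → ℝ) : Prop where
  le_self : ∀ n : ℕ, 1 ≤ n → (n : ℝ) ≤ f n
  succ_le : ∃ c > 0, ∀ n : ℕ, 1 ≤ n → (1 + 2 * α / n) * f n + c ≤ f (n + 1)
  succ_le' : ∀ n : ℕ, 1 ≤ n → (1 + 1 / n) * f n ≤ f (n + 1)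

lemma isMomentRate_diffusive {α : ℝ} (hα : α < 1 / 2) : IsMomentRate α fun n => n where
  le_self n _ := le_rfl
  succ_le := ⟨1 - 2 * α, by linarith, fun n hn => by
    have : (n : ℝ) ≠ 0 := by positivity
    apply le_of_eq; push_cast; field_simp; ring⟩
  succ_le' n hn := by
    have : (n : ℝ) ≠ 0 := by positivity
    apply le_of_eq; push_cast; field_simp

/-- The increment of `log` from `n` to `n + 1` is at least `1 / (n + 1)`, which pays for the
additive constant `1`. -/
lemma isMomentRate_critical : IsMomentRate (1 / 2) fun n => n * (1 + Real.log n) := by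
  have key : ∀ n : ℕ, 1 ≤ n → (1 + 1 / (n : ℝ)) * (n * (1 + Real.log n)) + 1 ≤
      ((n + 1 : ℕ) : ℝ) * (1 + Real.log (n + 1 : ℕ)) := by
    intro n hn
    have hn' : (0 : ℝ) < n := by positivity
    have h1 : Real.log n ≤ Real.log (n + 1) - 1 / (n + 1) := by
      have := Real.log_le_sub_one_of_pos (x := (n : ℝ) / (n + 1)) (by positivity)
      rw [Real.log_div (by positivity) (by positivity)] at this
      have h2 : (n : ℝ) / (n + 1) - 1 = - (1 / (n + 1)) := by field_simp; ring
      linarith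
    have h2 : (1 + 1 / (n : ℝ)) * (n * (1 + Real.log n)) = (n + 1) * (1 + Real.log n) := by
      field_simp
    have h3 := mul_le_mul_of_nonneg_left h1 (by positivity : (0 : ℝ) ≤ n + 1)
    have h4 : ((n : ℝ) + 1) * (1 / (n + 1)) = 1 := by field_simp
    rw [h2]
    push_cast
    linarith
  refine ⟨fun n hn => ?_, ⟨1, one_pos, fun n hn => ?_⟩, fun n hn => ?_⟩
  · have : (0 : ℝ) ≤ Real.log n := Real.log_natCast_nonneg n
    have : (0 : ℝ) ≤ n := by positivity
    nlinarith
  · simpa using key n hn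
  · linarith [key n hn]

/-- By Bernoulli's inequality `n^{2α}` satisfies the homogeneous inequality; subtracting `n` creates
the additive slack `2α - 1 > 0`. -/
lemma isMomentRate_superdiffusive {α : ℝ} (hα : 1 / 2 < α) :
    IsMomentRate α fun n => 2 * (n : ℝ) ^ (2 * α) - n := by
  have hle : ∀ n : ℕ, 1 ≤ n → (n : ℝ) ≤ (n : ℝ) ^ (2 * α) := fun n hn => by
    simpa using Real.rpow_le_rpow_of_exponent_le (x := (n : ℝ)) (by exact_mod_cast hn)
      (by linarith : 1 ≤ 2 * α)
  have hstep : ∀ n : ℕ, 1 ≤ n → (1 + 2 * α / n) * (n : ℝ) ^ (2 * α) ≤ ((n : ℝ) + 1) ^ (2 * α) := by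
    intro n hn
    have hn' : (0 : ℝ) < n := by positivity
    have h := one_add_mul_self_le_rpow_one_add (s := 1 / (n : ℝ))
      (by linarith [(by positivity : (0 : ℝ) ≤ 1 / n)]) (by linarith : 1 ≤ 2 * α)
    have h2 : (n : ℝ) + 1 = (1 + 1 / n) * n := by field_simp
    rw [h2, Real.mul_rpow (by positivity) (by positivity)]
    refine mul_le_mul_of_nonneg_right ?_ (by positivity)
    rwa [mul_one_div] at h
  refine ⟨fun n hn => by linarith [hle n hn], ⟨2 * α - 1, by linarith, fun n hn => ?_⟩,
    fun n hn => ?_⟩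
  · have hn' : (n : ℝ) ≠ 0 := by positivity
    have h1 : (1 + 2 * α / n) * (2 * (n : ℝ) ^ (2 * α) - n) =
      2 * ((1 + 2 * α / n) * (n : ℝ) ^ (2 * α)) - n - 2 * α := by field_simp; ring
    push_cast
    linarith [hstep n hn]
  · have hn' : (0 : ℝ) < n := by positivity
    have h1 : (1 + 1 / (n : ℝ)) * (2 * (n : ℝ) ^ (2 * α) - n) =
      2 * ((1 + 1 / n) * (n : ℝ) ^ (2 * α)) - (n + 1) := by field_simp
    have h2 : (1 + 1 / (n : ℝ)) * (n : ℝ) ^ (2 * α) ≤ (1 + 2 * α / n) * (n : ℝ) ^ (2 * α) := by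
      gcongr; linarith
    push_cast
    linarith [hstep n hn]

namespace IsMomentRate

variable {α : ℝ} {f : ℕ → ℝ}

/-- Induction on `n`. The bound `α ≥ -1/2` keeps the factor `1 + 2α/n` nonnegative from `n = 1` on,
so the induction hypothesis can be multiplied by it. -/
lemma exists_le_mul_of_succ_le (hf : IsMomentRate α f) (hα : -(1 / 2) ≤ α) {v : ℕ → ℝ} {C : ℝ}
    (hv : ∀ n : ℕ, 1 ≤ n → v (n + 1) ≤ (1 + 2 * α / n) * v n + C) :
    ∃ K, 0 ≤ K ∧ ∀ n : ℕ, 1 ≤ n → v n ≤ K * f n := by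
  obtain ⟨c, hc, hsucc⟩ := hf.succ_le
  refine ⟨max |v 1| (|C| / c), by positivity, fun n hn => ?_⟩
  set K := max |v 1| (|C| / c) with hK
  have hK0 : 0 ≤ K := by positivity
  have hCK : C ≤ K * c := (le_abs_self C).trans ((div_le_iff₀ hc).1 (le_max_right _ _))
  induction n, hn using Nat.le_induction with
  | base =>
    have h1 := hf.le_self 1 le_rfl
    have h2 : v 1 ≤ K := (le_abs_self _).trans (le_max_left _ _)
    push_cast at h1
    nlinarith
  | succ n hn ih =>
    have hn' : (1 : ℝ) ≤ n := by exact_mod_cast hn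
    have h0 : 0 ≤ 1 + 2 * α / n := by
      have : -1 ≤ 2 * α / n := by rw [le_div_iff₀ (by linarith)]; linarith
      linarith
    have h1 := mul_le_mul_of_nonneg_left ih h0
    have h2 := mul_le_mul_of_nonneg_left (hsucc n hn) hK0
    linarith [hv n hn]

/-- Since `f` gains the factor `1 + 1/n` and `y` only `1 + 1/(2n)`, a surplus `K f(n) / (2n)` is
left, which absorbs `C f(n) / n` once `K ≥ 2C`. -/
lemma exists_le_mul_of_succ_le' (hf : IsMomentRate α f) {y : ℕ → ℝ} {C : ℝ}
    (hy : ∀ n : ℕ, 1 ≤ n → y (n + 1) ≤ (1 + 1 / (2 * n)) * y n + C * f n / n) :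
    ∃ K, 0 ≤ K ∧ ∀ n : ℕ, 1 ≤ n → y n ≤ K * f n := by
  refine ⟨max |y 1| (2 * |C|), by positivity, fun n hn => ?_⟩
  set K := max |y 1| (2 * |C|) with hK
  have hK0 : 0 ≤ K := by positivity
  have hCK : 2 * C ≤ K := by linarith [le_abs_self C, le_max_right |y 1| (2 * |C|)]
  induction n, hn using Nat.le_induction with
  | base =>
    have h1 := hf.le_self 1 le_rfl
    have h2 : y 1 ≤ K := (le_abs_self _).trans (le_max_left _ _)
    push_cast at h1
    nlinarith
  | succ n hn ih =>
    have hn' : (0 : ℝ) < n := by positivity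
    have hfn : 0 ≤ f n / n := div_nonneg (hn'.le.trans (hf.le_self n hn)) hn'.le
    have h1 := mul_le_mul_of_nonneg_left ih (by positivity : (0 : ℝ) ≤ 1 + 1 / (2 * n))
    have h2 := mul_le_mul_of_nonneg_left (hf.succ_le' n hn) hK0
    have h3 := mul_le_mul_of_nonneg_right hCK hfn
    have h4 : (1 + 1 / (2 * (n : ℝ))) * (K * f n) = K * f n + K * (f n / n) / 2 := by
      field_simp
    have h5 : K * ((1 + 1 / n) * f n) = K * f n + K * (f n / n) := by field_simp
    have h6 : C * f n / n = C * (f n / n) := by ring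
    linarith [hy n hn]

end IsMomentRate

/-- The second moments grow at the rate prescribed by `speedRate`. -/
lemma exists_isMomentRate_speedRate {d : ℕ} (hd : 3 ≤ d) (p : ℝ) :
    ∃ f : ℕ → ℝ, IsMomentRate (((d : ℝ) * p - 1) / ((d : ℝ) - 1)) f ∧
      ∃ C, ∀ n : ℕ, 1 ≤ n → speedRate d p n ^ 2 * f n ≤ C * (n : ℝ) ^ 2 := by
  have hd' : (3 : ℝ) ≤ d := by exact_mod_cast hd
  -- Comparing `p` with `p_d` amounts to comparing `α` with `1/2`.
  have hhalf : ((d : ℝ) * p - 1) / ((d : ℝ) - 1) - 1 / 2 =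
      d / (d - 1) * (p - criticalMemory d) := by
    rw [criticalMemory]
    field_simp [(by linarith : (d : ℝ) - 1 ≠ 0)]
    ring
  have hpos : 0 < (d : ℝ) / (d - 1) := div_pos (by linarith) (by linarith)
  rcases lt_trichotomy p (criticalMemory d) with h | h | h
  · refine ⟨_, isMomentRate_diffusive (by nlinarith), 1, fun n hn => ?_⟩
    rw [speedRate, if_pos h, ← Real.sqrt_eq_rpow, Real.sq_sqrt (by positivity)]
    apply le_of_eq; ring
  · have hα : ((d : ℝ) * p - 1) / ((d : ℝ) - 1) = 1 / 2 := by
      rw [h, sub_self, mul_zero, ← h] at hhalf; linarith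
    -- The ratio to be bounded is `1 + 1 / log n`, largest at `n = 2`; at `n = 1` the rate is `0` by
    -- convention.
    refine ⟨_, hα ▸ isMomentRate_critical, 1 + 1 / Real.log 2, fun n hn => ?_⟩
    have hlog := Real.log_natCast_nonneg n
    rw [speedRate, if_neg h.not_lt, if_pos h, ← Real.sqrt_eq_rpow, Real.sq_sqrt (by positivity)]
    rcases hn.eq_or_lt with rfl | hn
    · simp; positivity
    · have h2 : Real.log 2 ≤ Real.log n := Real.log_le_log (by norm_num) (by exact_mod_cast hn)
      have h2' : 0 < Real.log 2 := Real.log_pos (by norm_num)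
      have hl : 0 < Real.log n := by linarith
      have h3 : (n : ℝ) / Real.log n * (n * (1 + Real.log n)) =
          (1 + 1 / Real.log n) * n ^ 2 := by field_simp; ring
      rw [h3]
      gcongr
  · set α := ((d : ℝ) * p - 1) / ((d : ℝ) - 1) with hα
    refine ⟨_, isMomentRate_superdiffusive (by nlinarith), 2, fun n hn => ?_⟩
    have hn' : (0 : ℝ) < n := by positivity
    have he : (d : ℝ) * (1 - p) / ((d : ℝ) - 1) = 1 - α := by
      rw [hα]; field_simp [(by linarith : (d : ℝ) - 1 ≠ 0)]; ring
    rw [speedRate, if_neg h.not_gt, if_neg h.ne', he]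
    have h1 : ((n : ℝ) ^ (1 - α)) ^ 2 * (n : ℝ) ^ (2 * α) = n ^ 2 := by
      rw [← Real.rpow_natCast, ← Real.rpow_mul hn'.le, ← Real.rpow_add hn', ← Real.rpow_natCast]
      congr 1; push_cast; ring
    have h2 : 0 ≤ ((n : ℝ) ^ (1 - α)) ^ 2 * n := by positivity
    nlinarith

/-! ### Second moments of the step counts and of the distance -/

section Walk

variable {Γ Ω : Type*} {S : Finset Γ}

section Excess

variable [DecidableEq Γ]

lemma stepExcess_succ (g : ℕ → Ω → S) (n : ℕ) (a : S) (ω : Ω) :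
    stepExcess g (n + 1) a ω =
      stepExcess g n a ω + (if g (n + 1) ω = a then 1 else 0) - 1 / (S.card : ℝ) := by
  rw [stepExcess, stepCount, Finset.sum_Icc_succ_top (by omega), ← stepCount, stepExcess]
  push_cast
  ring

/-- The mean of a function of the next step which takes two values. -/
lemma sum_stepProb_mul_ite (hS : 2 ≤ S.card) (p : ℝ) (g : ℕ → Ω → S) (n : ℕ) (c : S) (ω : Ω)
    (x y : ℝ) :
    ∑ b, stepProb p g n b ω * (if b = c then x else y) = y + stepProb p g n c ω * (x - y) := by
  have : ∀ b, stepProb p g n b ω * (if b = c then x else y) =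
      stepProb p g n b ω * y + if b = c then stepProb p g n b ω * (x - y) else 0 := by
    intro b
    split_ifs <;> ring
  simp only [this, Finset.sum_add_distrib, ← Finset.sum_mul, sum_stepProb hS, one_mul,
    Finset.sum_ite_eq', Finset.mem_univ, if_true]

lemma stepProb_le_one (hS : 2 ≤ S.card) {p : ℝ} (hp : p ∈ Set.Icc (0 : ℝ) 1) (g : ℕ → Ω → S)
    {n : ℕ} (hn : 1 ≤ n) (b : S) (ω : Ω) : stepProb p g n b ω ≤ 1 :=
  (Finset.single_le_sum (f := fun b => stepProb p g n b ω)
    (fun b _ => stepProb_nonneg hS hp g hn b ω) (Finset.mem_univ b)).trans_eq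
    (sum_stepProb hS p g n ω)

/-- The cross term `2X(P - δ)`, with `δ = 1/d`, equals `(2α/n) X²` exactly; the remainder `δ² + P -
2Pδ` is at most `2`. -/
lemma IsElephantWalk.integral_stepExcess_sq_succ_le [MeasurableSpace Ω] {μ : Measure Ω}
    [IsProbabilityMeasure μ] {p : ℝ} {g : ℕ → Ω → S} {D : ℕ → Ω → ℕ}
    (hg : IsElephantWalk S p μ g D) (hS : 2 ≤ S.card) (hp : p ∈ Set.Icc (0 : ℝ) 1) {n : ℕ}
    (hn : 1 ≤ n) (a : S) :
    ∫ ω, stepExcess g (n + 1) a ω ^ 2 ∂μ ≤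
      (1 + 2 * reinforcement S.card p / n) * ∫ ω, stepExcess g n a ω ^ 2 ∂μ + 2 := by
  have hd : (2 : ℝ) ≤ S.card := by exact_mod_cast hS
  have hd1 : 1 / (S.card : ℝ) ≤ 1 := by rw [div_le_one (by linarith)]; linarith
  have hd0 : 0 ≤ 1 / (S.card : ℝ) := by positivity
  have hX := stepExcess_factorsThrough g n a
  simp only [stepExcess_succ]
  rw [hg.integral_step hS hn
    (F := fun b ω => (stepExcess g n a ω + (if b = a then 1 else 0) - 1 / (S.card : ℝ)) ^ 2)
    fun b ω ω' h => by simp only [hX h]]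
  have hI : Integrable (fun ω => stepExcess g n a ω ^ 2) μ :=
    hg.integrable_of_factorsThrough (n := n) fun ω ω' h => by simp only [hX h]
  have hR : ∫ ω, ((1 + 2 * reinforcement S.card p / n) * stepExcess g n a ω ^ 2 + 2) ∂μ =
      (1 + 2 * reinforcement S.card p / n) * ∫ ω, stepExcess g n a ω ^ 2 ∂μ + 2 := by
    rw [integral_add (hI.const_mul _) (integrable_const _), integral_const_mul]
    simp
  rw [← hR]
  refine integral_mono (hg.integrable_of_factorsThrough (n := n) fun ω ω' h => ?_)
    ((hI.const_mul _).add (integrable_const _)) fun ω => ?_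
  · simp only [hX h, stepProb_factorsThrough p g n _ h]
  · have h1 : ∀ b : S, (stepExcess g n a ω + (if b = a then 1 else 0) - 1 / (S.card : ℝ)) ^ 2 =
        if b = a then (stepExcess g n a ω + 1 - 1 / (S.card : ℝ)) ^ 2
          else (stepExcess g n a ω - 1 / (S.card : ℝ)) ^ 2 := fun b => by
      split_ifs <;> ring
    simp only [h1]
    rw [sum_stepProb_mul_ite hS]
    have hP0 := stepProb_nonneg hS hp g hn a ω
    have hP1 := stepProb_le_one hS hp g hn a ω
    have hP : stepProb p g n a ω = 1 / (S.card : ℝ) +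
      reinforcement S.card p * stepExcess g n a ω / n := rfl
    set X := stepExcess g n a ω
    set P := stepProb p g n a ω
    set δ := 1 / (S.card : ℝ)
    have h2 : (X - δ) ^ 2 + P * ((X + 1 - δ) ^ 2 - (X - δ) ^ 2) =
        X ^ 2 + 2 * X * (P - δ) + δ ^ 2 + P - 2 * (P * δ) := by ring
    have h3 : 2 * X * (P - δ) = 2 * reinforcement S.card p / n * X ^ 2 := by rw [hP]; ring
    rw [h2, h3]
    nlinarith [mul_nonneg hP0 hd0]

end Excess

variable [Group Γ]

lemma walkPosition_factorsThrough (g : ℕ → Ω → S) (n : ℕ) :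
    (walkPosition g n).FactorsThrough (history g n) := by
  induction n with
  | zero => exact fun _ _ _ => rfl
  | succ n ih =>
    intro ω ω' h
    rw [history_eq_iff] at h
    have h' : history g n ω = history g n ω' := history_eq_iff.2 fun k hk =>
      h k (Finset.Icc_subset_Icc_right n.le_succ hk)
    rw [walkPosition, walkPosition, h _ (Finset.mem_Icc.2 ⟨by omega, le_rfl⟩), ih h']

/-- The deviation of the distance from `n (d - 2) / d`. -/
noncomputable def distExcess (g : ℕ → Ω → S) (n : ℕ) (ω : Ω) : ℝ :=
  walkDistance g n ω - n * (1 - 2 * (1 / (S.card : ℝ)))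

lemma distExcess_factorsThrough (g : ℕ → Ω → S) (n : ℕ) :
    (distExcess g n).FactorsThrough (history g n) := fun ω ω' h => by
  rw [distExcess, distExcess, walkDistance, walkDistance, walkPosition_factorsThrough g n h]

lemma normalizedSpeed_eq {d : ℕ} (hcard : S.card = d) (hd : d ≠ 0) (p : ℝ) (g : ℕ → Ω → S)
    {n : ℕ} (hn : 1 ≤ n) (ω : Ω) :
    normalizedSpeed d p g n ω = speedRate d p n / n * distExcess g n ω := by
  have hn' : (n : ℝ) ≠ 0 := by positivity
  have hd' : (d : ℝ) ≠ 0 := by exact_mod_cast hd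
  rw [normalizedSpeed, distExcess, hcard]
  field_simp

variable [DecidableEq Γ]

/-- The conditional second moment of the excess distance after one more step. At the identity the
excess distance is nonpositive, so that the reflection there does no harm. -/
lemma sum_stepProb_mul_distExcess_sq_le (hS : 2 ≤ S.card) (hsymm : ∀ s ∈ S, s⁻¹ ∈ S)
    (hone : (1 : Γ) ∉ S) (htree : (leftCayleyGraph S).IsTree) {p : ℝ}
    (hp : p ∈ Set.Icc (0 : ℝ) 1) (g : ℕ → Ω → S) {n : ℕ} (hn : 1 ≤ n) (ω : Ω) :
    ∑ b : S, stepProb p g n b ω * (((leftCayleyGraph S).dist ((b : Γ) * walkPosition g n ω) 1 : ℝ) -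
        (n + 1 : ℕ) * (1 - 2 * (1 / (S.card : ℝ)))) ^ 2 ≤
      (1 + 1 / (2 * n)) * distExcess g n ω ^ 2 +
        8 * reinforcement S.card p ^ 2 / n * ∑ a, stepExcess g n a ω ^ 2 + 8 := by
  have hd : (2 : ℝ) ≤ S.card := by exact_mod_cast hS
  have hd1 : 1 / (S.card : ℝ) ≤ 1 / 2 := one_div_le_one_div_of_le (by norm_num) hd
  have hd0 : 0 ≤ 1 / (S.card : ℝ) := by positivity
  have hn' : (0 : ℝ) < n := by positivity
  have hY : distExcess g n ω = ((leftCayleyGraph S).dist (walkPosition g n ω) 1 : ℝ) -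
    n * (1 - 2 * (1 / (S.card : ℝ))) := rfl
  have hV : 0 ≤ ∑ a, stepExcess g n a ω ^ 2 := Finset.sum_nonneg fun _ _ => sq_nonneg _
  have hα : 0 ≤ 8 * reinforcement S.card p ^ 2 / n := by positivity
  by_cases hw : walkPosition g n ω = 1
  · rw [hw, SimpleGraph.dist_self] at hY
    simp only [hw, mul_one, dist_generator_one hone]
    rw [← Finset.sum_mul, sum_stepProb hS, one_mul]
    set Y := distExcess g n ω
    set δ := 1 / (S.card : ℝ)
    have h1 : (((1 : ℕ) : ℝ) - (n + 1 : ℕ) * (1 - 2 * δ)) ^ 2 = (Y + 2 * δ) ^ 2 := by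
      rw [hY]; push_cast; ring
    have hY0 : Y ≤ 0 := by rw [hY]; push_cast; nlinarith
    have h2 : (Y + 2 * δ) ^ 2 ≤ Y ^ 2 + 8 := by nlinarith [mul_nonneg (neg_nonneg.2 hY0) hd0]
    have h3 : 0 ≤ 1 / (2 * (n : ℝ)) * Y ^ 2 := by positivity
    rw [h1]
    linarith [mul_nonneg hα hV]
  · obtain ⟨c, hc⟩ := exists_forall_dist_mul_left hsymm hone htree hw
    -- The shortening generator `c` varies with `ω`; summing over all generators gives a bound that
    -- can be integrated.
    have hXV : stepExcess g n c ω ^ 2 ≤ ∑ a, stepExcess g n a ω ^ 2 :=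
      Finset.single_le_sum (f := fun a => stepExcess g n a ω ^ 2) (fun _ _ => sq_nonneg _)
        (Finset.mem_univ c)
    have hP0 := stepProb_nonneg hS hp g hn c ω
    have hP1 := stepProb_le_one hS hp g hn c ω
    have hP : stepProb p g n c ω = 1 / (S.card : ℝ) +
      reinforcement S.card p * stepExcess g n c ω / n := rfl
    set Y := distExcess g n ω
    have h1 : ∀ b : S, (((leftCayleyGraph S).dist ((b : Γ) * walkPosition g n ω) 1 : ℝ) -
        (n + 1 : ℕ) * (1 - 2 * (1 / (S.card : ℝ)))) ^ 2 =
        if b = c then (Y - 2 + 2 * (1 / (S.card : ℝ))) ^ 2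
          else (Y + 2 * (1 / (S.card : ℝ))) ^ 2 := by
      intro b
      rw [hc b, hY]
      push_cast
      split_ifs <;> ring
    simp only [h1]
    rw [sum_stepProb_mul_ite hS]
    set X := stepExcess g n c ω
    set P := stepProb p g n c ω
    set δ := 1 / (S.card : ℝ)
    set α := reinforcement S.card p
    have h2 : (Y + 2 * δ) ^ 2 + P * ((Y - 2 + 2 * δ) ^ 2 - (Y + 2 * δ) ^ 2) =
        Y ^ 2 - 4 * Y * (P - δ) + 4 * δ ^ 2 + 4 * P - 8 * (P * δ) := by ring
    -- Young's inequality, weighted so that `Y²` has coefficient `1/2`: anything below `1` leaves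
    -- the surplus needed in `exists_le_mul_of_succ_le'`.
    have h3 : -(4 * Y * (P - δ)) ≤ (Y ^ 2 / 2 + 8 * (α * X) ^ 2) / n := by
      have : -(4 * Y * (P - δ)) = -(4 * Y * (α * X)) / n := by rw [hP]; ring
      rw [this]
      gcongr
      nlinarith [sq_nonneg (Y + 4 * (α * X))]
    have h4 : (Y ^ 2 / 2 + 8 * (α * X) ^ 2) / n =
        1 / (2 * n) * Y ^ 2 + 8 * α ^ 2 / n * X ^ 2 := by field_simp
    have h5 := mul_le_mul_of_nonneg_left hXV hα
    rw [h2]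
    nlinarith [mul_nonneg hP0 hd0]

namespace IsElephantWalk

variable [MeasurableSpace Ω] {μ : Measure Ω} {p : ℝ} {g : ℕ → Ω → S} {D : ℕ → Ω → ℕ}
  [IsProbabilityMeasure μ]

lemma integral_distExcess_sq_succ_le (hg : IsElephantWalk S p μ g D) (hS : 2 ≤ S.card)
    (hsymm : ∀ s ∈ S, s⁻¹ ∈ S) (hone : (1 : Γ) ∉ S) (htree : (leftCayleyGraph S).IsTree)
    (hp : p ∈ Set.Icc (0 : ℝ) 1) {n : ℕ} (hn : 1 ≤ n) :
    ∫ ω, distExcess g (n + 1) ω ^ 2 ∂μ ≤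
      (1 + 1 / (2 * n)) * ∫ ω, distExcess g n ω ^ 2 ∂μ +
        8 * reinforcement S.card p ^ 2 / n * ∑ a, ∫ ω, stepExcess g n a ω ^ 2 ∂μ + 8 := by
  have hW := walkPosition_factorsThrough g n
  have hstep : ∫ ω, distExcess g (n + 1) ω ^ 2 ∂μ = _ := hg.integral_step hS hn
    (F := fun b ω => (((leftCayleyGraph S).dist ((b : Γ) * walkPosition g n ω) 1 : ℝ) -
        (n + 1 : ℕ) * (1 - 2 * (1 / (S.card : ℝ)))) ^ 2)
    fun b ω ω' h => by simp only [hW h]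
  have hY : Integrable (fun ω => distExcess g n ω ^ 2) μ :=
    hg.integrable_of_factorsThrough (n := n) fun ω ω' h => by
      simp only [distExcess_factorsThrough g n h]
  have hX : ∀ a, Integrable (fun ω => stepExcess g n a ω ^ 2) μ := fun a =>
    hg.integrable_of_factorsThrough (n := n) fun ω ω' h => by
      simp only [stepExcess_factorsThrough g n a h]
  have hV : Integrable (fun ω => ∑ a, stepExcess g n a ω ^ 2) μ :=
    integrable_finsetSum _ fun a _ => hX a
  have hR : ∫ ω, ((1 + 1 / (2 * n)) * distExcess g n ω ^ 2 +
        8 * reinforcement S.card p ^ 2 / n * ∑ a, stepExcess g n a ω ^ 2 + 8) ∂μ =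
      (1 + 1 / (2 * n)) * ∫ ω, distExcess g n ω ^ 2 ∂μ +
        8 * reinforcement S.card p ^ 2 / n * ∑ a, ∫ ω, stepExcess g n a ω ^ 2 ∂μ + 8 := by
    rw [integral_add (by exact (hY.const_mul _).add (hV.const_mul _)) (integrable_const _),
      integral_add (hY.const_mul _) (hV.const_mul _), integral_const_mul, integral_const_mul,
      integral_finsetSum _ fun a _ => hX a]
    simp
  rw [hstep, ← hR]
  refine integral_mono (hg.integrable_of_factorsThrough (n := n) fun ω ω' h => ?_)
    (((hY.const_mul _).add (hV.const_mul _)).add (integrable_const _)) fun ω =>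
      sum_stepProb_mul_distExcess_sq_le hS hsymm hone htree hp g hn ω
  simp only [hW h, stepProb_factorsThrough p g n _ h]

lemma exists_integral_distExcess_sq_le (hg : IsElephantWalk S p μ g D) (hS : 3 ≤ S.card)
    (hsymm : ∀ s ∈ S, s⁻¹ ∈ S) (hone : (1 : Γ) ∉ S) (htree : (leftCayleyGraph S).IsTree)
    (hp : p ∈ Set.Icc (0 : ℝ) 1) {f : ℕ → ℝ} (hf : IsMomentRate (reinforcement S.card p) f) :
    ∃ K, 0 ≤ K ∧ ∀ n : ℕ, 1 ≤ n → ∫ ω, distExcess g n ω ^ 2 ∂μ ≤ K * f n := by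
  have hS2 : 2 ≤ S.card := by omega
  have hd : (3 : ℝ) ≤ S.card := by exact_mod_cast hS
  -- Here `d ≥ 3` enters: `α ≥ -1/(d - 1) ≥ -1/2`.
  have hα : -(1 / 2) ≤ reinforcement S.card p := by
    rw [reinforcement, le_div_iff₀ (by linarith)]
    nlinarith [hp.1]
  choose K hK0 hK using fun a : S => hf.exists_le_mul_of_succ_le hα
    (v := fun n => ∫ ω, stepExcess g n a ω ^ 2 ∂μ)
    fun n hn => hg.integral_stepExcess_sq_succ_le hS2 hp hn a
  refine hf.exists_le_mul_of_succ_le' (C := 8 * reinforcement S.card p ^ 2 * (∑ a, K a) + 8)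
    fun n hn => (hg.integral_distExcess_sq_succ_le hS2 hsymm hone htree hp hn).trans ?_
  have hn' : (0 : ℝ) < n := by positivity
  have h1 : ∑ a, ∫ ω, stepExcess g n a ω ^ 2 ∂μ ≤ (∑ a, K a) * f n := by
    rw [Finset.sum_mul]
    exact Finset.sum_le_sum fun a _ => hK a n hn
  have h2 := mul_le_mul_of_nonneg_left h1
    (by positivity : 0 ≤ 8 * reinforcement S.card p ^ 2 / n)
  -- This lets the additive `8` be absorbed into the `f(n) / n` term.
  have h3 : 1 ≤ f n / n := (one_le_div hn').2 (hf.le_self n hn)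
  have h4 : (8 * reinforcement S.card p ^ 2 * (∑ a, K a) + 8) * f n / n =
    8 * reinforcement S.card p ^ 2 / n * ((∑ a, K a) * f n) + 8 * (f n / n) := by ring
  linarith

end IsElephantWalk

end Walk

/-! ### Tightness from second moments -/

/-- Real random variables with bounded second moments are tight. -/
lemma isTightMeasureSet_map_of_integral_sq_le {Ω : Type*} [MeasurableSpace Ω] {μ : Measure Ω}
    [IsFiniteMeasure μ] {I : Set ℕ} {Z : ℕ → Ω → ℝ} (hm : ∀ n ∈ I, Measurable (Z n))
    (hi : ∀ n ∈ I, Integrable (fun ω => Z n ω ^ 2) μ) {M : ℝ}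
    (hM : ∀ n ∈ I, ∫ ω, Z n ω ^ 2 ∂μ ≤ M) :
    IsTightMeasureSet {ν : Measure ℝ | ∃ n, n ∈ I ∧ ν = μ.map (Z n)} := by
  rw [isTightMeasureSet_iff_exists_isCompact_measure_compl_le]
  intro ε hε
  rcases eq_or_ne ε ⊤ with rfl | hε'
  · exact ⟨∅, isCompact_empty, fun _ _ => le_top⟩
  have he : 0 < ε.toReal := ENNReal.toReal_pos hε.ne' hε'
  -- The radius is the one for which Chebyshev's inequality yields `ε`; `|M| + 1` makes it positive
  -- whatever the sign of `M`.
  refine ⟨Metric.closedBall 0 √((|M| + 1) / ε.toReal), isCompact_closedBall _ _, ?_⟩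
  rintro _ ⟨n, hn, rfl⟩
  rw [Measure.map_apply (hm n hn) Metric.isClosed_closedBall.measurableSet.compl,
    ← ofReal_measureReal]
  refine (ENNReal.ofReal_le_iff_le_toReal hε').2 ?_
  have h1 := mul_meas_ge_le_integral_of_nonneg (.of_forall fun ω => sq_nonneg (Z n ω)) (hi n hn)
    ((|M| + 1) / ε.toReal)
  have h2 : μ.real (Z n ⁻¹' (Metric.closedBall 0 √((|M| + 1) / ε.toReal))ᶜ) ≤
      μ.real {ω | (|M| + 1) / ε.toReal ≤ Z n ω ^ 2} := by
    refine measureReal_mono fun ω hω => ?_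
    simp only [Set.mem_preimage, Set.mem_compl_iff, mem_closedBall_zero_iff, not_le,
      Real.norm_eq_abs] at hω
    have h := Real.sqrt_lt' (abs_pos.2 fun h => ?_) |>.1 hω
    · rw [sq_abs] at h
      exact h.le
    · rw [h, abs_zero] at hω
      exact hω.not_ge (Real.sqrt_nonneg _)
  have h3 : (|M| + 1) / ε.toReal * μ.real (Z n ⁻¹' (Metric.closedBall 0
      √((|M| + 1) / ε.toReal))ᶜ) ≤ |M| + 1 := by
    have := mul_le_mul_of_nonneg_left h2 (by positivity : 0 ≤ (|M| + 1) / ε.toReal)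
    linarith [hM n hn, le_abs_self M]
  rw [div_mul_eq_mul_div, div_le_iff₀ he] at h3
  exact le_of_mul_le_mul_left h3 (by positivity)

theorem mainTheorem5 {Γ : Type*} [Group Γ] [DecidableEq Γ] (S : Finset Γ) (d : ℕ)
    (hd : 3 ≤ d) (hcard : S.card = d)
    (hsymm : ∀ s ∈ S, s⁻¹ ∈ S) (hone : (1 : Γ) ∉ S)
    (hgen : Subgroup.closure (S : Set Γ) = ⊤)
    (htree : (leftCayleyGraph S).IsTree)
    (p : ℝ) (hp : p ∈ Set.Ico (0 : ℝ) 1)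
    {Ω : Type*} [MeasurableSpace Ω] (μ : Measure Ω) [IsProbabilityMeasure μ]
    (g : ℕ → Ω → S) (D : ℕ → Ω → ℕ) (hg : IsElephantWalk S p μ g D) :
    (∀ n : ℕ, 1 ≤ n → Measurable (normalizedSpeed d p g n)) ∧
      IsTightMeasureSet {ν : Measure ℝ | ∃ n : ℕ, 1 ≤ n ∧
        ν = μ.map (normalizedSpeed d p g n)} := by
  have hfac : ∀ n : ℕ, 1 ≤ n → (normalizedSpeed d p g n).FactorsThrough (history g n) :=
    fun n hn ω ω' h => by
      rw [normalizedSpeed_eq hcard (by omega) p g hn, normalizedSpeed_eq hcard (by omega) p g hn,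
        distExcess_factorsThrough g n h]
  -- For a map that is not a.e. measurable, `μ.map` is zero by default and tightness would be void;
  -- measurability is thus part of the claim.
  have hm : ∀ n : ℕ, 1 ≤ n → Measurable (normalizedSpeed d p g n) := fun n hn =>
    hg.measurable_of_factorsThrough (hfac n hn)
  refine ⟨hm, ?_⟩
  obtain ⟨f, hf, C, hC⟩ := exists_isMomentRate_speedRate hd p
  obtain ⟨K, hK0, hK⟩ := hg.exists_integral_distExcess_sq_le (hcard ▸ hd) hsymm hone htree
    ⟨hp.1, hp.2.le⟩ (f := f) (by rwa [hcard])
  refine isTightMeasureSet_map_of_integral_sq_le (I := {n | 1 ≤ n}) hm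
    (fun n hn => hg.integrable_of_factorsThrough (n := n) fun ω ω' h => by
      simp only [hfac n hn h]) (M := K * C) fun n hn => ?_
  have hn' : (0 : ℝ) < n := by exact_mod_cast hn
  simp only [normalizedSpeed_eq hcard (by omega) p g hn, mul_pow, integral_const_mul]
  calc (speedRate d p n / n) ^ 2 * ∫ ω, distExcess g n ω ^ 2 ∂μ
      ≤ (speedRate d p n / n) ^ 2 * (K * f n) := by gcongr; exact hK n hn
    _ = K * (speedRate d p n ^ 2 * f n) / n ^ 2 := by ring
    _ ≤ K * (C * n ^ 2) / n ^ 2 := 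
      div_le_div_of_nonneg_right (mul_le_mul_of_nonneg_left (hC n hn) hK0) (by positivity)
    _ = K * C := by field_simp
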